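/- Let $L_n$ denote the Legendre polynomial of degree $n$ on $(-1,1)$. For $n\ge 0$ let $H_n := L_{2n}/\|L_{2n}\|_{L^2(0,1)}$ on $(0,1)$, so that $\int_0^1 H_m H_n\,d\mu=\delta_{m,n}$. For odd $N\ge 3$ put $M=(N-1)/2$ and let $\mathbf M_\mu(\mu^2)\in\mathbb R^{(M+1)\times(M+1)}$ be the matrix with entries $$[\mathbf M_\mu(\mu^2)]_{m,n}=\int_0^1 \mu^2 H_m(\mu)H_n(\mu)\,d\mu,\qquad 0\le m,n\le M.$$ Then there exist real numbers $c_N>1$ ($N\ge 3$ odd) and constants $a,b>0$ independent of $N$ such that, for every odd $N\ge 3$, $$a\,N^{-2}\le |1-c_N|\le b\,N^{-2}$$ and $$c_N N^{-4}\|\mathbf v\|_2^2\le \langle \mathbf M_\mu(\mu^2)\mathbf v,\mathbf v\rangle\le \|\mathbf v\|_2^2\qquad\text{for all }\mathbf v\in\mathbb R^{M+1}.$$ -/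

import Mathlib

/-- The Legendre polynomial `L_n` on `(-1,1)`, by Rodrigues' formula
`L_n = (2 ^ n * n!)⁻¹ * (d/dX) ^ n (X ^ 2 - 1) ^ n`. -/
noncomputable def legendrePoly (n : ℕ) : Polynomial ℝ :=
  Polynomial.C ((2 ^ n * (Nat.factorial n : ℝ))⁻¹) *
    (Polynomial.derivative^[n]) ((Polynomial.X ^ 2 - 1) ^ n)

/-- The `P_N` basis function `H_n` on `(0,1)`: the even Legendre polynomial `L_{2n}`, divided by
its norm in `L²(0,1)`. -/
noncomputable def angularBasis (n : ℕ) (μ : ℝ) : ℝ :=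
  (legendrePoly (2 * n)).eval μ / √(∫ s in (0 : ℝ)..1, ((legendrePoly (2 * n)).eval s) ^ 2)

/-- The weighted angular mass matrix `M_μ(η)`, with entries `∫₀¹ η H_m H_n dμ`, `0 ≤ m, n ≤ M`. -/
noncomputable def angularMassMatrix (M : ℕ) (η : ℝ → ℝ) : Matrix (Fin (M + 1)) (Fin (M + 1)) ℝ :=
  Matrix.of fun m n => ∫ μ in (0 : ℝ)..1, η μ * angularBasis m μ * angularBasis n μ

/-! Write p = ∑ vᵢ Hᵢ. The quadratic form is ∫₀¹ x²p², and ‖v‖² = ∫₀¹ p², so the upper bound is x² ≤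
1. For the lower bound, p cannot concentrate at x = 0 without a large derivative. Legendre's
equation makes the Hᵢ orthogonal for the energy ∫ (1 - x²) p'² too, with eigenvalues 2i(2i + 1), so
this energy is at most K‖v‖² with K = (N - 1)N. The Heisenberg-type inequality
`mul_unitIntegral_sq_le` then yields ‖v‖² ≤ (4K + 6) ∫ x²p². This lower bound is of order N⁻², far
stronger than N⁻⁴, which leaves room for c_N = 1 + N⁻². -/

/-- Integration over `(0,1)` as a linear functional on real polynomials. -/
noncomputable def unitIntegral : Polynomial ℝ →ₗ[ℝ] ℝ where
  toFun f := ∫ x in (0 : ℝ)..1, f.eval x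
  map_add' f g := by
    simp only [Polynomial.eval_add]
    exact intervalIntegral.integral_add (f.continuous.intervalIntegrable _ _)
      (g.continuous.intervalIntegrable _ _)
  map_smul' r f := by simp

theorem unitIntegral_apply (f : Polynomial ℝ) :
    unitIntegral f = ∫ x in (0 : ℝ)..1, f.eval x := rfl

theorem unitIntegral_derivative (f : Polynomial ℝ) :
    unitIntegral (Polynomial.derivative f) = f.eval 1 - f.eval 0 :=
  intervalIntegral.integral_eq_sub_of_hasDerivAt (fun x _ => f.hasDerivAt x)
    ((Polynomial.derivative f).continuous.intervalIntegrable _ _)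

theorem unitIntegral_C_mul (r : ℝ) (f : Polynomial ℝ) :
    unitIntegral (Polynomial.C r * f) = r * unitIntegral f := by
  rw [← Polynomial.smul_eq_C_mul, map_smul, smul_eq_mul]

theorem unitIntegral_nonneg {f : Polynomial ℝ} (h : ∀ x ∈ Set.Icc (0 : ℝ) 1, 0 ≤ f.eval x) :
    0 ≤ unitIntegral f :=
  intervalIntegral.integral_nonneg zero_le_one h

theorem unitIntegral_sq_pos {f : Polynomial ℝ} (hf : f ≠ 0) : 0 < unitIntegral (f ^ 2) := by
  refine (unitIntegral_nonneg fun x _ => by simpa using sq_nonneg (f.eval x)).lt_of_ne' fun h => hf ?_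
  have hz : ∀ x ∈ Set.Ioo (0 : ℝ) 1, f.eval x = 0 := by
    intro x hx
    by_contra hne
    have hpos : 0 < ∫ x in (0 : ℝ)..1, (f ^ 2).eval x :=
      intervalIntegral.integral_pos zero_lt_one (f ^ 2).continuous.continuousOn
        (fun y _ => by simpa using sq_nonneg (f.eval y))
        ⟨x, Set.Ioo_subset_Icc_self hx, by simpa using pow_pos (abs_pos.2 hne) 2⟩
    exact hpos.ne' h
  exact f.eq_zero_of_infinite_isRoot ((Set.Ioo_infinite zero_lt_one).mono hz)

/-! ### Legendre's equation from Rodrigues' formula -/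

theorem X_sq_sub_one_mul_derivative_pow (n : ℕ) :
    (Polynomial.X ^ 2 - 1) * Polynomial.derivative ((Polynomial.X ^ 2 - 1 : Polynomial ℝ) ^ n) =
      2 * (n : Polynomial ℝ) * (Polynomial.X * (Polynomial.X ^ 2 - 1) ^ n) := by
  have h2 : (Polynomial.C 2 : Polynomial ℝ) = 2 := rfl
  cases n with
  | zero => simp
  | succ n => simp [Polynomial.derivative_pow, h2]; ring

/-- Leibniz's rule applied k + 1 times to the hypothesis. The case u = (X² - 1)ⁿ, k = n is
Legendre's equation for u⁽ⁿ⁾. -/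
theorem X_sq_sub_one_mul_iterate_derivative {u : Polynomial ℝ} {n : ℕ}
    (h : (Polynomial.X ^ 2 - 1) * Polynomial.derivative u =
      2 * (n : Polynomial ℝ) * (Polynomial.X * u)) (k : ℕ) :
    (Polynomial.X ^ 2 - 1) * Polynomial.derivative^[k + 2] u
      + 2 * ((k : Polynomial ℝ) + 1) * Polynomial.X * Polynomial.derivative^[k + 1] u
      + ((k : Polynomial ℝ) + 1) * (k : Polynomial ℝ) * Polynomial.derivative^[k] u
    = 2 * (n : Polynomial ℝ) * (Polynomial.X * Polynomial.derivative^[k + 1] u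
      + ((k : Polynomial ℝ) + 1) * Polynomial.derivative^[k] u) := by
  induction k with
  | zero =>
    have h' := congrArg Polynomial.derivative h
    simp only [Polynomial.derivative_sub, Polynomial.derivative_mul,
      Polynomial.derivative_natCast, Polynomial.derivative_ofNat, Polynomial.derivative_one,
      Polynomial.derivative_X, sq] at h'
    simp only [Function.iterate_succ_apply', Function.iterate_zero, id]
    push_cast
    linear_combination h'
  | succ k ih =>
    have h' := congrArg Polynomial.derivative ih
    simp only [Function.iterate_succ_apply', Polynomial.derivative_add, Polynomial.derivative_sub,
      Polynomial.derivative_mul, Polynomial.derivative_natCast, Polynomial.derivative_ofNat,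
      Polynomial.derivative_one, Polynomial.derivative_X, sq] at h'
    simp only [Function.iterate_succ_apply']
    push_cast
    linear_combination h'

/-- Legendre's differential equation. -/
theorem derivative_one_sub_sq_mul_derivative_legendrePoly (n : ℕ) :
    Polynomial.derivative ((1 - Polynomial.X ^ 2) * Polynomial.derivative (legendrePoly n)) =
      -(Polynomial.C ((n : ℝ) * (n + 1)) * legendrePoly n) := by
  have h := X_sq_sub_one_mul_iterate_derivative (X_sq_sub_one_mul_derivative_pow n) n
  unfold legendrePoly
  simp only [Function.iterate_succ_apply'] at h
  generalize (2 ^ n * (Nat.factorial n : ℝ))⁻¹ = r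
  simp [Polynomial.derivative_mul]
  linear_combination -(Polynomial.C r) * h

theorem legendrePoly_ne_zero (n : ℕ) : legendrePoly n ≠ 0 := by
  have hdeg : ((Polynomial.X ^ 2 - 1 : Polynomial ℝ) ^ n).coeff (n + n) = 1 := by
    have hm : (Polynomial.X ^ 2 - 1 : Polynomial ℝ).Monic := by
      simpa using Polynomial.monic_X_pow_sub_C (1 : ℝ) two_ne_zero
    have hd : (Polynomial.X ^ 2 - 1 : Polynomial ℝ).natDegree = 2 := by
      simpa using Polynomial.natDegree_X_pow_sub_C (n := 2) (r := (1 : ℝ))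
    have := (hm.pow n).coeff_natDegree
    rwa [hm.natDegree_pow, hd, mul_two] at this
  refine mul_ne_zero (by simp [Nat.factorial_ne_zero]) fun h => ?_
  -- The monic top term X²ⁿ contributes the nonzero coefficient (2n)!/n! in degree n.
  have hc := congrArg (fun p => p.coeff n) h
  simp only [Polynomial.coeff_iterate_derivative, hdeg, Polynomial.coeff_zero, nsmul_eq_mul,
    mul_one, Nat.cast_eq_zero, Nat.descFactorial_eq_zero_iff_lt] at hc
  omega

/-! ### Orthogonality on the half interval -/

theorem eval_zero_derivative_legendrePoly_even (n : ℕ) :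
    (Polynomial.derivative (legendrePoly (2 * n))).eval 0 = 0 := by
  have hu : ((Polynomial.X ^ 2 - 1 : Polynomial ℝ) ^ (2 * n))
      = Polynomial.expand ℝ 2 ((Polynomial.X - 1) ^ (2 * n)) := by simp
  have : (Polynomial.derivative^[2 * n + 1]
      ((Polynomial.X ^ 2 - 1 : Polynomial ℝ) ^ (2 * n))).eval 0 = 0 := by
    rw [← Polynomial.coeff_zero_eq_eval_zero, Polynomial.coeff_iterate_derivative, hu,
      Polynomial.coeff_expand two_pos, if_neg (by omega), smul_zero]
  rw [legendrePoly, Polynomial.derivative_C_mul, Polynomial.eval_mul,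
    ← Function.iterate_succ_apply' (f := Polynomial.derivative), this, mul_zero]

/-- Integration by parts in Legendre's equation. The boundary term vanishes at 1 because of the
weight, and at 0 because an even polynomial has zero derivative there. -/
theorem unitIntegral_one_sub_sq_mul_derivative_legendrePoly (n : ℕ) (q : Polynomial ℝ) :
    unitIntegral ((1 - Polynomial.X ^ 2) * Polynomial.derivative (legendrePoly (2 * n)) *
      Polynomial.derivative q) =
    2 * n * (2 * n + 1) * unitIntegral (legendrePoly (2 * n) * q) := by
  have h := unitIntegral_derivative
    ((1 - Polynomial.X ^ 2) * Polynomial.derivative (legendrePoly (2 * n)) * q)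
  rw [Polynomial.derivative_mul, derivative_one_sub_sq_mul_derivative_legendrePoly, map_add,
    neg_mul, map_neg, mul_assoc (Polynomial.C _), unitIntegral_C_mul] at h
  simp [eval_zero_derivative_legendrePoly_even] at h
  linarith

/-- The energy form is symmetric, and the eigenvalues differ by 2(m - n)(2m + 2n + 1) ≠ 0. -/
theorem unitIntegral_legendrePoly_mul_of_ne {m n : ℕ} (h : m ≠ n) :
    unitIntegral (legendrePoly (2 * m) * legendrePoly (2 * n)) = 0 := by
  have h1 := unitIntegral_one_sub_sq_mul_derivative_legendrePoly m (legendrePoly (2 * n))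
  have h2 := unitIntegral_one_sub_sq_mul_derivative_legendrePoly n (legendrePoly (2 * m))
  rw [mul_right_comm, h1, mul_comm (legendrePoly (2 * n))] at h2
  have h3 : ((m : ℝ) - n) * ((2 * m + 2 * n + 1) *
      unitIntegral (legendrePoly (2 * m) * legendrePoly (2 * n))) = 0 := by linarith
  have hmn : (m : ℝ) - n ≠ 0 := sub_ne_zero.2 (by exact_mod_cast h)
  have hs : (2 * m + 2 * n + 1 : ℝ) ≠ 0 := by positivity
  simpa [hmn, hs] using h3

/-- The basis function `H_n` as a polynomial. -/
noncomputable def angularPoly (n : ℕ) : Polynomial ℝ :=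
  Polynomial.C (√(unitIntegral (legendrePoly (2 * n) ^ 2)))⁻¹ * legendrePoly (2 * n)

theorem eval_angularPoly (n : ℕ) (x : ℝ) : (angularPoly n).eval x = angularBasis n x := by
  simp [angularPoly, angularBasis, unitIntegral_apply, div_eq_inv_mul]

theorem unitIntegral_angularPoly_mul (m n : ℕ) :
    unitIntegral (angularPoly m * angularPoly n) = if m = n then 1 else 0 := by
  rw [angularPoly, angularPoly, mul_mul_mul_comm, ← Polynomial.C_mul, unitIntegral_C_mul]
  split_ifs with h
  · subst h
    have hp := unitIntegral_sq_pos (legendrePoly_ne_zero (2 * m))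
    rw [← sq (legendrePoly _), ← mul_inv, Real.mul_self_sqrt hp.le, inv_mul_cancel₀ hp.ne']
  · rw [unitIntegral_legendrePoly_mul_of_ne h, mul_zero]

theorem unitIntegral_one_sub_sq_mul_derivative_angularPoly (m n : ℕ) :
    unitIntegral ((1 - Polynomial.X ^ 2) * (Polynomial.derivative (angularPoly m) *
      Polynomial.derivative (angularPoly n))) =
    2 * m * (2 * m + 1) * if m = n then 1 else 0 := by
  rw [← unitIntegral_angularPoly_mul, ← mul_assoc]
  conv_lhs => rw [angularPoly]
  conv_rhs => rw [angularPoly]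
  rw [Polynomial.derivative_C_mul, mul_left_comm, mul_assoc (Polynomial.C _),
    mul_assoc (Polynomial.C _), unitIntegral_C_mul, unitIntegral_C_mul,
    unitIntegral_one_sub_sq_mul_derivative_legendrePoly]
  ring

/-- The polynomial with coefficients `v` in the basis `H_0, …, H_M`. -/
noncomputable def angularSum {M : ℕ} (v : Fin (M + 1) → ℝ) : Polynomial ℝ :=
  ∑ i, Polynomial.C (v i) * angularPoly i

theorem unitIntegral_mul_angularSum_sq {M : ℕ} (w : Polynomial ℝ) (v : Fin (M + 1) → ℝ) :
    unitIntegral (w * angularSum v ^ 2) =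
      ∑ i, ∑ j, v i * v j * unitIntegral (w * (angularPoly i * angularPoly j)) := by
  rw [angularSum, sq, Finset.sum_mul_sum, Finset.mul_sum, map_sum]
  refine Finset.sum_congr rfl fun i _ => ?_
  rw [Finset.mul_sum, map_sum]
  refine Finset.sum_congr rfl fun j _ => ?_
  rw [← unitIntegral_C_mul, Polynomial.C_mul]
  congr 1
  ring

theorem unitIntegral_angularSum_sq {M : ℕ} (v : EuclideanSpace ℝ (Fin (M + 1))) :
    unitIntegral (angularSum v ^ 2) = ‖v‖ ^ 2 := by
  have h := unitIntegral_mul_angularSum_sq 1 v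
  simp only [one_mul, unitIntegral_angularPoly_mul, Fin.val_inj] at h
  rw [h, EuclideanSpace.real_norm_sq_eq]
  simp [sq]

theorem unitIntegral_one_sub_sq_mul_derivative_angularSum_sq_le {M : ℕ}
    (v : EuclideanSpace ℝ (Fin (M + 1))) :
    unitIntegral ((1 - Polynomial.X ^ 2) * Polynomial.derivative (angularSum v) ^ 2) ≤
      2 * M * (2 * M + 1) * ‖v‖ ^ 2 := by
  have h : unitIntegral ((1 - Polynomial.X ^ 2) * Polynomial.derivative (angularSum v) ^ 2) =
      ∑ i : Fin (M + 1), 2 * (i : ℝ) * (2 * i + 1) * v i ^ 2 := by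
    rw [angularSum, Polynomial.derivative_sum, sq (Finset.sum _ _), Finset.sum_mul_sum,
      Finset.mul_sum, map_sum]
    refine Finset.sum_congr rfl fun i _ => ?_
    rw [Finset.mul_sum, map_sum, Finset.sum_eq_single i]
    · rw [Polynomial.derivative_C_mul, mul_mul_mul_comm, ← Polynomial.C_mul, mul_left_comm,
        unitIntegral_C_mul, unitIntegral_one_sub_sq_mul_derivative_angularPoly, if_pos rfl]
      ring
    · intro j _ hj
      rw [Polynomial.derivative_C_mul, Polynomial.derivative_C_mul, mul_mul_mul_comm,
        ← Polynomial.C_mul, mul_left_comm, unitIntegral_C_mul,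
        unitIntegral_one_sub_sq_mul_derivative_angularPoly,
        if_neg (fun e => hj (Fin.ext e.symm)), mul_zero, mul_zero]
    · simp
  rw [h, EuclideanSpace.real_norm_sq_eq, Finset.mul_sum]
  gcongr with i _ <;> exact_mod_cast Nat.lt_succ_iff.1 i.2

theorem inner_angularMassMatrix {M : ℕ} (v : EuclideanSpace ℝ (Fin (M + 1))) :
    inner ℝ (Matrix.toEuclideanLin (angularMassMatrix M (fun μ => μ ^ 2)) v) v =
      unitIntegral (Polynomial.X ^ 2 * angularSum v ^ 2) := by
  rw [unitIntegral_mul_angularSum_sq, PiLp.inner_apply]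
  refine Finset.sum_congr rfl fun i _ => ?_
  simp only [Matrix.toLpLin_apply, Matrix.mulVec, dotProduct, angularMassMatrix, Matrix.of_apply,
    RCLike.inner_apply, conj_trivial, Finset.mul_sum, unitIntegral_apply, Polynomial.eval_mul,
    Polynomial.eval_pow, Polynomial.eval_X, eval_angularPoly, ← mul_assoc]
  exact Finset.sum_congr rfl fun j _ => by ring

/-- An uncertainty inequality on `(0,1)` relating the second moment and the Legendre energy. -/
theorem mul_unitIntegral_sq_le (p : Polynomial ℝ) (t : ℝ) :
    t * unitIntegral (p ^ 2) ≤ (t ^ 2 + 3 * t) * unitIntegral (Polynomial.X ^ 2 * p ^ 2) +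
      unitIntegral ((1 - Polynomial.X ^ 2) * Polynomial.derivative p ^ 2) := by
  -- Integrate the derivative of x(1 - x²)p², which vanishes at both endpoints.
  have hparts : unitIntegral (p ^ 2) - 3 * unitIntegral (Polynomial.X ^ 2 * p ^ 2) +
      2 * unitIntegral (Polynomial.X * (1 - Polynomial.X ^ 2) * p * Polynomial.derivative p) = 0 := by
    have h := unitIntegral_derivative (Polynomial.X * (1 - Polynomial.X ^ 2) * p ^ 2)
    have e : Polynomial.derivative (Polynomial.X * (1 - Polynomial.X ^ 2) * p ^ 2) =
        p ^ 2 - Polynomial.C 3 * (Polynomial.X ^ 2 * p ^ 2) + Polynomial.C 2 *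
          (Polynomial.X * (1 - Polynomial.X ^ 2) * p * Polynomial.derivative p) := by
      have h3 : (Polynomial.C 3 : Polynomial ℝ) = 3 := rfl
      have h2 : (Polynomial.C 2 : Polynomial ℝ) = 2 := rfl
      simp [Polynomial.derivative_mul, Polynomial.derivative_pow, h3, h2]
      ring
    rw [e, map_add, map_sub, unitIntegral_C_mul, unitIntegral_C_mul] at h
    simpa using h
  -- As in Heisenberg's inequality, expand a weighted square; its cross term is the one in `hparts`.
  have hsq : 0 ≤ unitIntegral ((1 - Polynomial.X ^ 2) *
      (Polynomial.C t * Polynomial.X * p + Polynomial.derivative p) ^ 2) := by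
    refine unitIntegral_nonneg fun x hx => ?_
    simp only [Polynomial.eval_mul, Polynomial.eval_sub, Polynomial.eval_one, Polynomial.eval_pow,
      Polynomial.eval_X]
    exact mul_nonneg (by nlinarith [hx.1, hx.2]) (sq_nonneg _)
  -- The fourth moment enters the expansion with factor -t², so it can be dropped.
  have hfour : 0 ≤ unitIntegral ((Polynomial.X ^ 2 * p) ^ 2) :=
    unitIntegral_nonneg fun x _ => by rw [Polynomial.eval_pow]; positivity
  have hexp : (1 - Polynomial.X ^ 2) *
      (Polynomial.C t * Polynomial.X * p + Polynomial.derivative p) ^ 2 =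
      Polynomial.C (t ^ 2) * (Polynomial.X ^ 2 * p ^ 2)
      - Polynomial.C (t ^ 2) * (Polynomial.X ^ 2 * p) ^ 2
      + Polynomial.C (2 * t) * (Polynomial.X * (1 - Polynomial.X ^ 2) * p * Polynomial.derivative p)
      + (1 - Polynomial.X ^ 2) * Polynomial.derivative p ^ 2 := by
    have h2 : (Polynomial.C 2 : Polynomial ℝ) = 2 := rfl
    rw [Polynomial.C_mul, Polynomial.C_pow, h2]
    ring
  rw [hexp, map_add, map_add, map_sub, unitIntegral_C_mul, unitIntegral_C_mul,
    unitIntegral_C_mul] at hsq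
  nlinarith [mul_nonneg (sq_nonneg t) hfour, congrArg (t * ·) hparts]

theorem lemma5p1 :
    ∃ c : ℕ → ℝ,
      (∃ a b : ℝ, 0 < a ∧ 0 < b ∧ ∀ N : ℕ, Odd N → 3 ≤ N →
        a * (N : ℝ) ^ (-2 : ℤ) ≤ |1 - c N| ∧ |1 - c N| ≤ b * (N : ℝ) ^ (-2 : ℤ)) ∧
      ∀ N M : ℕ, N = 2 * M + 1 → 3 ≤ N →
        1 < c N ∧
        ∀ v : EuclideanSpace ℝ (Fin (M + 1)),
          c N * (N : ℝ) ^ (-4 : ℤ) * ‖v‖ ^ 2 ≤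
            inner ℝ (Matrix.toEuclideanLin (angularMassMatrix M (fun μ => μ ^ 2)) v) v ∧
          inner ℝ (Matrix.toEuclideanLin (angularMassMatrix M (fun μ => μ ^ 2)) v) v ≤
            ‖v‖ ^ 2 := by
  -- With this choice |1 - c_N| equals N⁻², so a = b = 1.
  refine ⟨fun N => 1 + (N : ℝ) ^ (-2 : ℤ), ⟨1, 1, one_pos, one_pos, fun N _ _ => ?_⟩, ?_⟩
  · have h : |1 - (1 + (N : ℝ) ^ (-2 : ℤ))| = (N : ℝ) ^ (-2 : ℤ) := by
      rw [sub_add_cancel_left, abs_neg, abs_of_nonneg (by positivity)]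
    simp
  intro N M hN h3
  have hN0 : (3 : ℝ) ≤ N := by exact_mod_cast h3
  have hNpos : (0 : ℝ) < N := by linarith
  refine ⟨lt_add_of_pos_right _ (by positivity), fun v => ?_⟩
  rw [inner_angularMassMatrix]
  constructor
  · have hD := unitIntegral_one_sub_sq_mul_derivative_angularSum_sq_le v
    have hM : (2 * M : ℝ) = N - 1 := by rw [hN]; push_cast; ring
    rw [hM, sub_add_cancel] at hD
    -- Taking t = 2K, half of t‖v‖² absorbs the energy bound K‖v‖²; dividing the rest by K gives
    -- `hA`.
    have hU := mul_unitIntegral_sq_le (angularSum v) (2 * ((N - 1) * N))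
    rw [unitIntegral_angularSum_sq] at hU
    set A := unitIntegral (Polynomial.X ^ 2 * angularSum v ^ 2)
    have hK : 0 < ((N : ℝ) - 1) * N := mul_pos (by linarith) hNpos
    have hA : ‖v‖ ^ 2 ≤ (4 * (((N : ℝ) - 1) * N) + 6) * A := by
      refine le_of_mul_le_mul_left ?_ hK
      linarith
    have hc : (1 + (N : ℝ) ^ (-2 : ℤ)) * (N : ℝ) ^ (-4 : ℤ) * (4 * (((N : ℝ) - 1) * N) + 6) ≤ 1 := by
      have e : (1 + (N : ℝ) ^ (-2 : ℤ)) * (N : ℝ) ^ (-4 : ℤ) = ((N : ℝ) ^ 2 + 1) / (N : ℝ) ^ 6 := by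
        rw [zpow_neg, zpow_neg]
        norm_cast
        push_cast
        field_simp
      rw [e, div_mul_eq_mul_div, div_le_one (by positivity)]
      -- N ≥ 3 suffices: the product is at most 2N² · 4N² = 8N⁴, and 8 ≤ N².
      have h9 : (9 : ℝ) ≤ (N : ℝ) ^ 2 := by nlinarith
      have h1 : 4 * (((N : ℝ) - 1) * N) + 6 ≤ 4 * (N : ℝ) ^ 2 := by nlinarith
      calc ((N : ℝ) ^ 2 + 1) * (4 * (((N : ℝ) - 1) * N) + 6)
          ≤ (2 * (N : ℝ) ^ 2) * (4 * (N : ℝ) ^ 2) := by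
            gcongr
            nlinarith
        _ = 8 * (N : ℝ) ^ 4 := by ring
        _ ≤ (N : ℝ) ^ 2 * (N : ℝ) ^ 4 := by gcongr; linarith
        _ = (N : ℝ) ^ 6 := by ring
    have hA0 : 0 ≤ A := unitIntegral_nonneg fun x _ => by
      rw [Polynomial.eval_mul, Polynomial.eval_pow, Polynomial.eval_pow]; positivity
    calc (1 + (N : ℝ) ^ (-2 : ℤ)) * (N : ℝ) ^ (-4 : ℤ) * ‖v‖ ^ 2
        ≤ (1 + (N : ℝ) ^ (-2 : ℤ)) * (N : ℝ) ^ (-4 : ℤ) *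
          ((4 * (((N : ℝ) - 1) * N) + 6) * A) := by gcongr
      _ ≤ A := by
        rw [← mul_assoc]
        exact mul_le_of_le_one_left hA0 hc
  · rw [← unitIntegral_angularSum_sq, ← sub_nonneg, ← map_sub]
    refine unitIntegral_nonneg fun x hx => ?_
    simp only [Polynomial.eval_sub, Polynomial.eval_mul, Polynomial.eval_pow, Polynomial.eval_X]
    have : x ^ 2 ≤ 1 := pow_le_one₀ hx.1 hx.2
    nlinarith [sq_nonneg ((angularSum v).eval x)]
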